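/- Let $R$ be an associative ring with identity and let $Q$ be a quiver (possibly infinite). $\mathrm{Rep}(Q,R)$ denotes the category of functors from the path category of $Q$ to left $R$-modules. For $S\in \mathrm{Rep}(Q^{\mathrm{op}},R^{\mathrm{op}})$ and $X\in\mathrm{Rep}(Q,R)$, let $S\otimes_Q X$ be the quotient of $\bigoplus_{i} S(i)\otimes_R X(i)$, the sum running over all vertices $i$ of $Q$, by the subgroup generated by the elements $S(a^{\mathrm{op}})(s)\otimes x-s\otimes X(a)(x)$, where $a\colon i\to j$ is an arrow of $Q$, $s\in S(j)$ and $x\in X(i)$. (The functor $-\otimes_Q X$ is left adjoint to $G\mapsto \mathrm{Hom}_{\mathbb Z}(X(-),G)$ from abelian groups to $\mathrm{Rep}(Q^{\mathrm{op}},R^{\mathrm{op}})$.) A short exact sequence $0\to X\to Y\to Z\to 0$ in $\mathrm{Rep}(Q,R)$ is pure if $0\to S\otimes_Q X\to S\otimes_Q Y\to S\otimes_Q Z\to 0$ is exact for every $S\in\mathrm{Rep}(Q^{\mathrm{op}},R^{\mathrm{op}})$. A representation $X$ is strongly fp-injective if there is an exact sequence $0\to X\to E^0\to E^1\to\cdots$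 in $\mathrm{Rep}(Q,R)$ with every $E^n$ injective that is pure, i.e. the short exact sequences $0\to X\to E^0\to\mathrm{Ker}(E^1\to E^2)\to 0$ and $0\to \mathrm{Ker}(E^n\to E^{n+1})\to E^n\to \mathrm{Ker}(E^{n+1}\to E^{n+2})\to 0$ for $n\ge 1$ are all pure. The quiver $Q$ is locally target-finite if every vertex is the source of only finitely many arrows. Define sets $W_\alpha$ of vertices for ordinals $\alpha$ by: $W_0=\emptyset$; $W_{\alpha+1}$ is the set of vertices $i$ such that every arrow with source $i$ has its target in $\bigcup_{\gamma\le\alpha}W_\gamma$; and $W_\alpha=\bigcup_{\beta<\alpha}W_\beta$ for limit $\alpha$. The quiver $Q$ is right rooted if some $W_\lambda$ is the set of all vertices. Suppose that $Q$ is locally target-finite and right rooted. If $(X_k)_{k\in I}$ is any family of strongly fp-injective representations of $Q$ by left $R$-modules, indexed by a set $I$, then the direct product $\prod_{k\in I}X_k$ is strongly fp-injective. -/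

import Mathlib

open CategoryTheory CategoryTheory.Limits

universe u

/-! ### Quivers -/

/-- A quiver is locally target-finite if every vertex is the source of only finitely many arrows. -/
def IsLocallyTargetFinite (Q : Type u) [Quiver.{u} Q] : Prop :=
  ∀ i : Q, Finite (Quiver.Star i)

/-- The transfinite sequence `W_α` of sets of vertices: `W_0 = ∅`; the set `W_{δ+1}` consists of
the vertices `i` such that every arrow with source `i` has its target in `⋃_{γ ≤ δ} W_γ`;
and `W_α = ⋃_{β < α} W_β` for a limit ordinal `α`. -/
def rootedSequence (Q : Type u) [Quiver.{u} Q] (α : Ordinal.{u}) : Set Q :=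
  {i | (∃ δ : Ordinal.{u}, ∃ _ : α = Order.succ δ,
          ∀ (j : Q) (_ : i ⟶ j), ∃ γ : Ordinal.{u}, ∃ _ : γ ≤ δ, j ∈ rootedSequence Q γ) ∨
        (Order.IsSuccLimit α ∧ ∃ β : Ordinal.{u}, ∃ _ : β < α, i ∈ rootedSequence Q β)}
termination_by α
decreasing_by
  · subst_vars
    exact Order.lt_succ_of_le (by assumption)
  · assumption

/-- A quiver is right rooted if `W_l` is the set of all vertices for some ordinal `l`. -/
def IsRightRooted (Q : Type u) [Quiver.{u} Q] : Prop :=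
  ∃ l : Ordinal.{u}, rootedSequence Q l = Set.univ

/-! ### Representations -/

/-- The category `Rep(Q, R)` of representations of the quiver `Q` by left `R`-modules:
functors from the path category of `Q` to the category of `R`-modules. -/
abbrev QuiverRep (R : Type u) [Ring R] (Q : Type u) [Quiver.{u} Q] :=
  Paths Q ⥤ ModuleCat.{u} R

namespace QuiverRep

variable {R : Type u} [Ring R] {Q : Type u} [Quiver.{u} Q]

/-- The module `X(i)` at a vertex `i`. -/
abbrev vertex (X : QuiverRep R Q) (i : Q) : ModuleCat.{u} R :=
  X.obj ((Paths.of Q).obj i)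

/-- The homomorphism `X(a) : X(i) → X(j)` at an arrow `a : i → j`. -/
abbrev arrow (X : QuiverRep R Q) {i j : Q} (a : i ⟶ j) : X.vertex i ⟶ X.vertex j :=
  X.map ((Paths.of Q).map a)

/-- The component `f(i) : X(i) → Y(i)` at a vertex `i` of a morphism of representations. -/
abbrev homAt {X Y : QuiverRep R Q} (f : X ⟶ Y) (i : Q) : X.vertex i ⟶ Y.vertex i :=
  f.app ((Paths.of Q).obj i)

/-! ### The tensor product over a quiver

Right `R`-modules are modules over `Rᵐᵒᵖ`, the right action of `r` on `s` being
`MulOpposite.op r • s`. -/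

/-- Generators of the tensor product `S ⊗_Q X`: the symbols `s ⊗ x`, where `s ∈ S(i)` and
`x ∈ X(i)` for one and the same vertex `i`. -/
abbrev TensorGen (S : QuiverRep Rᵐᵒᵖ Qᵒᵖ) (X : QuiverRep R Q) :=
  Σ i : Q, S.vertex (Opposite.op i) × X.vertex i

/-- The symbol `s ⊗ x` at the vertex `i` in the free abelian group. -/
def gen (S : QuiverRep Rᵐᵒᵖ Qᵒᵖ) (X : QuiverRep R Q) (i : Q)
    (s : S.vertex (Opposite.op i)) (x : X.vertex i) : FreeAbelianGroup (TensorGen S X) :=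
  FreeAbelianGroup.of ⟨i, s, x⟩

/-- The relators of the tensor product: biadditivity and `R`-balancedness at each vertex, and
`S(aᵒᵖ)(s) ⊗ x = s ⊗ X(a)(x)` for every arrow `a : i ⟶ j`, `s ∈ S(j)` and `x ∈ X(i)`. -/
inductive TensorRelator (S : QuiverRep Rᵐᵒᵖ Qᵒᵖ) (X : QuiverRep R Q) :
    FreeAbelianGroup (TensorGen S X) → Prop
  | add_left (i : Q) (s s' : S.vertex (Opposite.op i)) (x : X.vertex i) :
      TensorRelator S X (gen S X i (s + s') x - (gen S X i s x + gen S X i s' x))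
  | add_right (i : Q) (s : S.vertex (Opposite.op i)) (x x' : X.vertex i) :
      TensorRelator S X (gen S X i s (x + x') - (gen S X i s x + gen S X i s x'))
  | smul (i : Q) (r : R) (s : S.vertex (Opposite.op i)) (x : X.vertex i) :
      TensorRelator S X (gen S X i (MulOpposite.op r • s) x - gen S X i s (r • x))
  | arrow {i j : Q} (a : i ⟶ j) (s : S.vertex (Opposite.op j)) (x : X.vertex i) :
      TensorRelator S X
        (gen S X i ((S.arrow a.op).hom s) x - gen S X j s ((X.arrow a).hom x))

/-- The subgroup generated by the relators. -/
def tensorRelations (S : QuiverRep Rᵐᵒᵖ Qᵒᵖ) (X : QuiverRep R Q) :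
    AddSubgroup (FreeAbelianGroup (TensorGen S X)) :=
  AddSubgroup.closure {z | TensorRelator S X z}

/-- The tensor product `S ⊗_Q X`, an abelian group. -/
abbrev Tensor (S : QuiverRep Rᵐᵒᵖ Qᵒᵖ) (X : QuiverRep R Q) :=
  FreeAbelianGroup (TensorGen S X) ⧸ tensorRelations S X

/-- The homomorphism of free abelian groups sending `s ⊗ x` to `s ⊗ f(x)`. -/
def genMap (S : QuiverRep Rᵐᵒᵖ Qᵒᵖ) {X Y : QuiverRep R Q} (f : X ⟶ Y) :
    FreeAbelianGroup (TensorGen S X) →+ FreeAbelianGroup (TensorGen S Y) :=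
  FreeAbelianGroup.map fun t => ⟨t.1, t.2.1, (homAt f t.1).hom t.2.2⟩

theorem genMap_gen (S : QuiverRep Rᵐᵒᵖ Qᵒᵖ) {X Y : QuiverRep R Q} (f : X ⟶ Y) (i : Q)
    (s : S.vertex (Opposite.op i)) (x : X.vertex i) :
    genMap S f (gen S X i s x) = gen S Y i s ((homAt f i).hom x) :=
  FreeAbelianGroup.map_of_apply _

theorem tensorRelations_le_comap (S : QuiverRep Rᵐᵒᵖ Qᵒᵖ) {X Y : QuiverRep R Q} (f : X ⟶ Y) :
    tensorRelations S X ≤ (tensorRelations S Y).comap (genMap S f) := by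
  refine (AddSubgroup.closure_le _).2 ?_
  rintro z hz
  refine AddSubgroup.subset_closure ?_
  change TensorRelator S Y (genMap S f z)
  cases hz with
  | add_left i s s' x =>
    simp only [map_sub, map_add, genMap_gen]
    exact .add_left i s s' _
  | add_right i s x x' =>
    simp only [map_sub, map_add, genMap_gen]
    exact .add_right i s _ _
  | smul i r s x =>
    simp only [map_sub, genMap_gen, map_smul]
    exact .smul i r s _
  | @arrow i j a s x =>
    have h : (homAt f j).hom ((X.arrow a).hom x) = (Y.arrow a).hom ((homAt f i).hom x) :=
      congrArg (fun g => g.hom x) (f.naturality ((Paths.of Q).map a))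
    simp only [map_sub, genMap_gen, h]
    exact .arrow a s _

/-- The homomorphism `S ⊗_Q f : S ⊗_Q X → S ⊗_Q Y`, `s ⊗ x ↦ s ⊗ f(x)`. -/
def tensorMap (S : QuiverRep Rᵐᵒᵖ Qᵒᵖ) {X Y : QuiverRep R Q} (f : X ⟶ Y) :
    Tensor S X →+ Tensor S Y :=
  QuotientAddGroup.map _ _ (genMap S f) (tensorRelations_le_comap S f)

/-! ### Purity and strongly fp-injective representations -/

/-- `0 → X → Y → Z → 0` is a pure exact sequence of representations: it is exact, and
`0 → S ⊗_Q X → S ⊗_Q Y → S ⊗_Q Z → 0` is exact for every representation `S` of `Qᵒᵖ` by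
right `R`-modules. -/
def IsPureExact (η : ShortComplex (QuiverRep R Q)) : Prop :=
  η.ShortExact ∧ ∀ S : QuiverRep Rᵐᵒᵖ Qᵒᵖ,
    Function.Injective (tensorMap S η.f) ∧
    Function.Exact (tensorMap S η.f) (tensorMap S η.g) ∧
    Function.Surjective (tensorMap S η.g)

/-- A pure acyclic injective resolution `0 → X → E⁰ → E¹ → ⋯` in `Rep(Q, R)`: an exact sequence
with all `Eⁿ` injective such that all the short exact sequences that it is spliced from,
`0 → X → E⁰ → Ker(E¹ → E²) → 0` and `0 → Ker(Eⁿ → Eⁿ⁺¹) → Eⁿ → Ker(Eⁿ⁺¹ → Eⁿ⁺²) → 0`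
for `n ≥ 1`, are pure. -/
structure PureInjectiveResolution (X : QuiverRep R Q) where
  /-- The terms of the resolution. -/
  E : ℕ → QuiverRep R Q
  /-- The augmentation. -/
  ε : X ⟶ E 0
  /-- The differentials. -/
  d (n : ℕ) : E n ⟶ E (n + 1)
  ε_d : ε ≫ d 0 = 0
  d_d (n : ℕ) : d n ≫ d (n + 1) = 0
  injective (n : ℕ) : Injective (E n)
  mono_ε : Mono ε
  exact_zero : (ShortComplex.mk ε (d 0) ε_d).Exact
  exact_succ (n : ℕ) : (ShortComplex.mk (d n) (d (n + 1)) (d_d n)).Exact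
  pure_zero : IsPureExact (ShortComplex.mk ε (kernel.lift (d 1) (d 0) (d_d 0))
    (by rw [← cancel_mono (kernel.ι (d 1))]; simp [ε_d]))
  pure_succ (n : ℕ) : IsPureExact (ShortComplex.mk (kernel.ι (d (n + 1)))
    (kernel.lift (d (n + 2)) (d (n + 1)) (d_d (n + 1)))
    (by rw [← cancel_mono (kernel.ι (d (n + 2)))]; simp))

/-- A representation is strongly fp-injective if it admits a pure acyclic injective resolution. -/
def IsStronglyFPInjective (X : QuiverRep R Q) : Prop :=
  Nonempty (PureInjectiveResolution X)

end QuiverRep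

/-! The termwise product of pure injective resolutions of the `X k` is again one, for `∏ᶜ X`.
Products of injectives are injective, and products of exact sequences of representations are exact
because both are tested on the modules at the vertices (`epi_piMap`, `exact_piMap`). What needs
proof is that purity survives products.

Tensoring over a quiver is right exact (`tensorMap_exact`), so purity of a short exact sequence is a
property of its monomorphism (`isPureExact_iff`). That property descends solvability of finite
linear systems: if finitely many relations of some `S` express a constant from `X` over `Y`, they
already do so over `X` (`IsPureMono.mem_range_system`). To see this, test purity on `Hom_ℤ(X(-),
A)`, with `A` the cokernel of the system over `X`, and evaluate.

An element of `S ⊗_Q ∏ X k` that dies in `S ⊗_Q ∏ Y k` does so because of a finite set `F` of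
relations. The same `F` works in every component, so the system is solved in each `X k`, and the
solutions assemble to one in the product (`IsPureMono.piMap`). -/

namespace QuiverRep

variable {R : Type u} [Ring R] {Q : Type u} [Quiver.{u} Q]

/-! ### Elements of the tensor product over a quiver -/

/-- The class of the symbol `s ⊗ x` in `S ⊗_Q X`. -/
def tmul (S : QuiverRep Rᵐᵒᵖ Qᵒᵖ) (X : QuiverRep R Q) (i : Q)
    (s : S.vertex (Opposite.op i)) (x : X.vertex i) : Tensor S X :=
  QuotientAddGroup.mk (gen S X i s x)

section

variable (S : QuiverRep Rᵐᵒᵖ Qᵒᵖ) (X : QuiverRep R Q)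

theorem mk_eq_of_relator {a b : FreeAbelianGroup (TensorGen S X)}
    (h : TensorRelator S X (a - b)) :
    (QuotientAddGroup.mk a : Tensor S X) = QuotientAddGroup.mk b :=
  (QuotientAddGroup.eq_iff_sub_mem).2 (AddSubgroup.subset_closure h)

theorem add_tmul (i : Q) (s s' : S.vertex (Opposite.op i)) (x : X.vertex i) :
    tmul S X i (s + s') x = tmul S X i s x + tmul S X i s' x :=
  mk_eq_of_relator S X (.add_left i s s' x)

theorem tmul_add (i : Q) (s : S.vertex (Opposite.op i)) (x x' : X.vertex i) :
    tmul S X i s (x + x') = tmul S X i s x + tmul S X i s x' :=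
  mk_eq_of_relator S X (.add_right i s x x')

theorem smul_tmul (i : Q) (r : R) (s : S.vertex (Opposite.op i)) (x : X.vertex i) :
    tmul S X i (MulOpposite.op r • s) x = tmul S X i s (r • x) :=
  mk_eq_of_relator S X (.smul i r s x)

theorem arrow_tmul {i j : Q} (a : i ⟶ j) (s : S.vertex (Opposite.op j)) (x : X.vertex i) :
    tmul S X i ((S.arrow a.op).hom s) x = tmul S X j s ((X.arrow a).hom x) :=
  mk_eq_of_relator S X (.arrow a s x)

/-- The map `x ↦ s ⊗ x`. -/
def tmulHom (i : Q) (s : S.vertex (Opposite.op i)) : X.vertex i →+ Tensor S X :=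
  AddMonoidHom.mk' (tmul S X i s) (tmul_add S X i s)

@[simp]
theorem tmulHom_apply (i : Q) (s : S.vertex (Opposite.op i)) (x : X.vertex i) :
    tmulHom S X i s x = tmul S X i s x := rfl

variable {S X}

theorem tensor_hom_ext {A : Type*} [AddCommGroup A] {φ ψ : Tensor S X →+ A}
    (h : ∀ i s x, φ (tmul S X i s x) = ψ (tmul S X i s x)) : φ = ψ := by
  refine QuotientAddGroup.addMonoidHom_ext _ (FreeAbelianGroup.lift_ext _ _ ?_)
  rintro ⟨i, s, x⟩
  exact h i s x

theorem surjective_of_tmul_mem {A : Type*} [AddCommGroup A] (φ : A →+ Tensor S X)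
    (h : ∀ i s x, tmul S X i s x ∈ φ.range) : Function.Surjective φ := by
  have : QuotientAddGroup.mk' φ.range = 0 :=
    tensor_hom_ext fun i s x => (QuotientAddGroup.eq_zero_iff _).2 (h i s x)
  exact fun t => (QuotientAddGroup.eq_zero_iff t).1 (DFunLike.congr_fun this t)

/-- The homomorphism out of `S ⊗_Q X` induced by a family of maps that respects the relators. -/
def tensorLift {A : Type*} [AddCommGroup A]
    (φ : ∀ i : Q, S.vertex (Opposite.op i) → X.vertex i → A)
    (h_add : ∀ i s s' x, φ i (s + s') x = φ i s x + φ i s' x)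
    (add_h : ∀ i s x x', φ i s (x + x') = φ i s x + φ i s x')
    (h_smul : ∀ i (r : R) s x, φ i (MulOpposite.op r • s) x = φ i s (r • x))
    (h_arrow : ∀ {i j : Q} (a : i ⟶ j) s x,
      φ i ((S.arrow a.op).hom s) x = φ j s ((X.arrow a).hom x)) :
    Tensor S X →+ A :=
  QuotientAddGroup.lift _ (FreeAbelianGroup.lift fun t : TensorGen S X => φ t.1 t.2.1 t.2.2) <| by
    refine (AddSubgroup.closure_le _).2 ?_
    rintro z hz
    change FreeAbelianGroup.lift _ z = 0
    cases hz with
    | add_left i s s' x => simp [gen, h_add]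
    | add_right i s x x' => simp [gen, add_h]
    | smul i r s x => simp [gen, h_smul]
    | arrow a s x => simp [gen, h_arrow]

theorem tensorLift_tmul {A : Type*} [AddCommGroup A]
    (φ : ∀ i : Q, S.vertex (Opposite.op i) → X.vertex i → A) (h₁ h₂ h₃ h₄)
    (i : Q) (s : S.vertex (Opposite.op i)) (x : X.vertex i) :
    tensorLift (S := S) (X := X) φ h₁ h₂ h₃ h₄ (tmul S X i s x) = φ i s x :=
  FreeAbelianGroup.lift_apply_of _ _

end

theorem tensorMap_tmul (S : QuiverRep Rᵐᵒᵖ Qᵒᵖ) {X Y : QuiverRep R Q} (f : X ⟶ Y) (i : Q)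
    (s : S.vertex (Opposite.op i)) (x : X.vertex i) :
    tensorMap S f (tmul S X i s x) = tmul S Y i s ((homAt f i).hom x) :=
  congrArg QuotientAddGroup.mk (genMap_gen S f i s x)

theorem tensorMap_id (S : QuiverRep Rᵐᵒᵖ Qᵒᵖ) (X : QuiverRep R Q) :
    tensorMap S (𝟙 X) = AddMonoidHom.id _ :=
  tensor_hom_ext fun i s x => tensorMap_tmul S (𝟙 X) i s x

theorem tensorMap_comp (S : QuiverRep Rᵐᵒᵖ Qᵒᵖ) {X Y Z : QuiverRep R Q} (f : X ⟶ Y) (g : Y ⟶ Z) :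
    tensorMap S (f ≫ g) = (tensorMap S g).comp (tensorMap S f) :=
  tensor_hom_ext fun i s x => by
    simp only [AddMonoidHom.comp_apply, tensorMap_tmul]
    rfl

theorem homAt_arrow {X Y : QuiverRep R Q} (f : X ⟶ Y) {i j : Q} (a : i ⟶ j) (x : X.vertex i) :
    (homAt f j).hom ((X.arrow a).hom x) = (Y.arrow a).hom ((homAt f i).hom x) :=
  congrArg (fun g => g.hom x) (f.naturality ((Paths.of Q).map a))

/-! ### Right exactness -/

theorem homAt_surjective {X Y : QuiverRep R Q} (f : X ⟶ Y) [Epi f] (i : Q) :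
    Function.Surjective (homAt f i).hom :=
  (ModuleCat.epi_iff_surjective _).1 ((NatTrans.epi_iff_epi_app f).1 inferInstance _)

theorem tensorMap_surjective (S : QuiverRep Rᵐᵒᵖ Qᵒᵖ) {X Y : QuiverRep R Q} (f : X ⟶ Y) [Epi f] :
    Function.Surjective (tensorMap S f) := by
  refine surjective_of_tmul_mem _ fun i s y => ?_
  obtain ⟨x, rfl⟩ := homAt_surjective f i y
  exact ⟨tmul S X i s x, tensorMap_tmul S f i s x⟩

theorem tensorMap_exact (S : QuiverRep Rᵐᵒᵖ Qᵒᵖ) {η : ShortComplex (QuiverRep R Q)}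
    (hη : η.ShortExact) : Function.Exact (tensorMap S η.f) (tensorMap S η.g) := by
  have := hη.epi_g
  have hex (i : Q) (y : η.X₂.vertex i) (hy : (homAt η.g i).hom y = 0) :
      ∃ x, (homAt η.f i).hom x = y :=
    (ShortComplex.moduleCat_exact_iff _).1
      (hη.map_of_exact ((evaluation _ _).obj ((Paths.of Q).obj i))).exact y hy
  have hsurj := fun i => homAt_surjective η.g i
  let q := QuotientAddGroup.mk' (tensorMap S η.f).range
  -- Modulo the image of `S ⊗ f`, the class of `s ⊗ y` depends on `y` only through its image in
  -- `η.X₃`. Hence the set-theoretic section `lft`, which is not additive, still induces a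
  -- homomorphism `ψ`.
  have key (i : Q) (s) (y y' : η.X₂.vertex i)
      (h : (homAt η.g i).hom y = (homAt η.g i).hom y') :
      q (tmul S _ i s y) = q (tmul S _ i s y') := by
    obtain ⟨x, hx⟩ := hex i (y - y') (by rw [map_sub, h, sub_self])
    rw [← sub_eq_zero, ← map_sub]
    refine (QuotientAddGroup.eq_zero_iff (N := (tensorMap S η.f).range) _).2 ⟨tmul S _ i s x, ?_⟩
    rw [tensorMap_tmul, hx]
    exact map_sub (tmulHom S _ i s) y y'
  let lft (i : Q) (z : η.X₃.vertex i) : η.X₂.vertex i := Function.surjInv (hsurj i) z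
  have hlft (i : Q) (z) : (homAt η.g i).hom (lft i z) = z := Function.surjInv_eq (hsurj i) z
  let ψ : Tensor S η.X₃ →+ Tensor S η.X₂ ⧸ (tensorMap S η.f).range :=
    tensorLift (fun i s z => q (tmul S _ i s (lft i z)))
      (fun i s s' z => by rw [add_tmul, map_add])
      (fun i s z z' => by
        rw [← map_add, ← tmul_add]
        exact key _ _ _ _ (by rw [map_add, hlft, hlft, hlft]))
      (fun i r s z => by
        rw [smul_tmul]
        exact key _ _ _ _ (by rw [map_smul, hlft, hlft]))
      (fun {i j} a s z => by
        rw [arrow_tmul]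
        exact key _ _ _ _ (by rw [homAt_arrow, hlft, hlft]))
  -- The projection onto the cokernel of `S ⊗ f` factors through `S ⊗ g`, so the kernel of `S ⊗ g`
  -- lies in the image of `S ⊗ f`.
  have hψ : ψ.comp (tensorMap S η.g) = q := tensor_hom_ext fun i s y => by
    rw [AddMonoidHom.comp_apply, tensorMap_tmul, tensorLift_tmul]
    exact key _ _ _ _ (hlft _ _)
  intro t
  constructor
  · intro ht
    refine (QuotientAddGroup.eq_zero_iff (N := (tensorMap S η.f).range) t).1 ?_
    change q t = 0
    rw [← hψ, AddMonoidHom.comp_apply, ht, map_zero]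
  · rintro ⟨t, rfl⟩
    rw [← AddMonoidHom.comp_apply, ← tensorMap_comp, η.zero]
    have : tensorMap S (0 : η.X₁ ⟶ η.X₃) = 0 := tensor_hom_ext fun i s x => by
      rw [tensorMap_tmul]
      exact map_zero (tmulHom S _ i s)
    rw [this]; rfl

/-! ### Pure monomorphisms -/

/-- `S ⊗_Q f` is injective for every representation `S` of `Qᵒᵖ` by right `R`-modules. -/
def IsPureMono {X Y : QuiverRep R Q} (f : X ⟶ Y) : Prop :=
  ∀ S : QuiverRep Rᵐᵒᵖ Qᵒᵖ, Function.Injective (tensorMap S f)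

theorem isPureExact_iff {η : ShortComplex (QuiverRep R Q)} :
    IsPureExact η ↔ η.ShortExact ∧ IsPureMono η.f :=
  ⟨fun h => ⟨h.1, fun S => (h.2 S).1⟩, fun h => ⟨h.1, fun S =>
    have := h.1.epi_g
    ⟨h.2 S, tensorMap_exact S h.1, tensorMap_surjective S η.g⟩⟩⟩

theorem IsPureMono.comp {X Y Z : QuiverRep R Q} {f : X ⟶ Y} {g : Y ⟶ Z} (hf : IsPureMono f)
    (hg : IsPureMono g) : IsPureMono (f ≫ g) := fun S => by
  rw [tensorMap_comp]
  exact (hg S).comp (hf S)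

theorem IsPureMono.of_isIso {X Y : QuiverRep R Q} (f : X ⟶ Y) [IsIso f] : IsPureMono f := fun S =>
  Function.LeftInverse.injective (g := tensorMap S (inv f)) fun t => by
    rw [← AddMonoidHom.comp_apply, ← tensorMap_comp, IsIso.hom_inv_id, tensorMap_id]
    rfl

/-! ### A presentation of the tensor product -/

/-- The direct sum of copies of `X(i)`, one for every vertex `i` and every element of `S(i)`. -/
abbrev PreTensor (S : QuiverRep Rᵐᵒᵖ Qᵒᵖ) (X : QuiverRep R Q) :=
  DirectSum (Σ i : Q, S.vertex (Opposite.op i)) fun t => X.vertex t.1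

open Classical in
/-- The inclusion of the summand `X(i)` indexed by `s ∈ S(i)`. -/
noncomputable def preOf (S : QuiverRep Rᵐᵒᵖ Qᵒᵖ) (X : QuiverRep R Q) (i : Q)
    (s : S.vertex (Opposite.op i)) : X.vertex i →+ PreTensor S X :=
  DirectSum.of (fun t : Σ i : Q, S.vertex (Opposite.op i) => X.vertex t.1) ⟨i, s⟩

/-- The homomorphism between direct sums of copies induced by a morphism. -/
noncomputable def preMap (S : QuiverRep Rᵐᵒᵖ Qᵒᵖ) {X Y : QuiverRep R Q} (f : X ⟶ Y) :
    PreTensor S X →+ PreTensor S Y :=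
  DirectSum.map fun t => (homAt f t.1).hom.toAddMonoidHom

open Classical in
/-- The homomorphism out of the direct sum of copies induced by a family of homomorphisms. -/
noncomputable def preLift {S : QuiverRep Rᵐᵒᵖ Qᵒᵖ} {X : QuiverRep R Q} {A : Type*} [AddCommGroup A]
    (φ : ∀ i : Q, S.vertex (Opposite.op i) → X.vertex i →+ A) : PreTensor S X →+ A :=
  DirectSum.toAddMonoid fun t => φ t.1 t.2

section

variable (S : QuiverRep Rᵐᵒᵖ Qᵒᵖ) {X Y : QuiverRep R Q}

theorem preMap_preOf (f : X ⟶ Y) (i : Q) (s : S.vertex (Opposite.op i)) (x : X.vertex i) :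
    preMap S f (preOf S X i s x) = preOf S Y i s ((homAt f i).hom x) := by
  classical
  exact DirectSum.map_of _ _ _

variable {S} in
theorem preLift_preOf {A : Type*} [AddCommGroup A]
    (φ : ∀ i : Q, S.vertex (Opposite.op i) → X.vertex i →+ A) (i : Q)
    (s : S.vertex (Opposite.op i)) (x : X.vertex i) :
    preLift φ (preOf S X i s x) = φ i s x := by
  classical
  exact DirectSum.toAddMonoid_of _ _ _

variable {S} in
theorem pre_hom_ext {A : Type*} [AddCommGroup A] {φ ψ : PreTensor S X →+ A}
    (h : ∀ i s x, φ (preOf S X i s x) = ψ (preOf S X i s x)) : φ = ψ := by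
  classical
  exact DirectSum.addHom_ext fun t x => h t.1 t.2 x

end

/-- The relations of `S` starting at a vertex that present `S` by generators: additivity,
compatibility with scalars, and compatibility with arrows. -/
inductive Relation (S : QuiverRep Rᵐᵒᵖ Qᵒᵖ) : Q → Type u
  | add {i : Q} (s s' : S.vertex (Opposite.op i)) : Relation S i
  | smul {i : Q} (r : R) (s : S.vertex (Opposite.op i)) : Relation S i
  | arrow {i j : Q} (a : i ⟶ j) (s : S.vertex (Opposite.op j)) : Relation S i

/-- The action of a relation on the module of a representation at its vertex. -/
noncomputable def Relation.act {S : QuiverRep Rᵐᵒᵖ Qᵒᵖ} (X : QuiverRep R Q) {i : Q} :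
    Relation S i → (X.vertex i →+ PreTensor S X)
  | .add s s' => preOf S X i (s + s') - (preOf S X i s + preOf S X i s')
  | .smul r s => preOf S X i (MulOpposite.op r • s) -
      (preOf S X i s).comp (DistribSMul.toAddMonoidHom _ r)
  | .arrow (j := j) a s => preOf S X i ((S.arrow a.op).hom s) -
      (preOf S X j s).comp (X.arrow a).hom.toAddMonoidHom

theorem preMap_act {S : QuiverRep Rᵐᵒᵖ Qᵒᵖ} {X Y : QuiverRep R Q} (f : X ⟶ Y) {i : Q}
    (ρ : Relation S i) (x : X.vertex i) :
    preMap S f (ρ.act X x) = ρ.act Y ((homAt f i).hom x) := by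
  cases ρ with
  | add s s' => simp [Relation.act, preMap_preOf]
  | smul r s => simp [Relation.act, preMap_preOf]
  | arrow a s =>
    simp only [Relation.act, AddMonoidHom.sub_apply, map_sub, preMap_preOf,
      AddMonoidHom.comp_apply, LinearMap.toAddMonoidHom_coe, homAt_arrow]

/-- The projection of the direct sum of copies onto the tensor product. -/
noncomputable def preTo (S : QuiverRep Rᵐᵒᵖ Qᵒᵖ) (X : QuiverRep R Q) :
    PreTensor S X →+ Tensor S X :=
  preLift fun i s => tmulHom S X i s

theorem preTo_surjective (S : QuiverRep Rᵐᵒᵖ Qᵒᵖ) (X : QuiverRep R Q) :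
    Function.Surjective (preTo S X) :=
  surjective_of_tmul_mem _ fun i s x => ⟨preOf S X i s x, preLift_preOf _ _ _ _⟩

theorem tensorMap_preTo (S : QuiverRep Rᵐᵒᵖ Qᵒᵖ) {X Y : QuiverRep R Q} (f : X ⟶ Y)
    (b : PreTensor S X) : tensorMap S f (preTo S X b) = preTo S Y (preMap S f b) := by
  have : (tensorMap S f).comp (preTo S X) = (preTo S Y).comp (preMap S f) :=
    pre_hom_ext fun i s x => by
      simp [preTo, preLift_preOf, preMap_preOf, tensorMap_tmul]
  exact DFunLike.congr_fun this b

theorem preTo_act {S : QuiverRep Rᵐᵒᵖ Qᵒᵖ} {X : QuiverRep R Q} {i : Q}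
    (ρ : Relation S i) (x : X.vertex i) : preTo S X (ρ.act X x) = 0 := by
  cases ρ with
  | add s s' => simp [Relation.act, preTo, preLift_preOf, add_tmul]
  | smul r s => simp [Relation.act, preTo, preLift_preOf, smul_tmul]
  | arrow a s =>
    simp only [Relation.act, preTo, AddMonoidHom.sub_apply, map_sub, preLift_preOf,
      AddMonoidHom.comp_apply, LinearMap.toAddMonoidHom_coe, tmulHom_apply, arrow_tmul, sub_self]

/-- The finite linear system given by a finite set of relations. -/
noncomputable def system {S : QuiverRep Rᵐᵒᵖ Qᵒᵖ} (F : Finset (Σ i : Q, Relation S i))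
    (X : QuiverRep R Q) : (∀ l : Σ i : Q, Relation S i, X.vertex l.1) →+ PreTensor S X :=
  ∑ l ∈ F, (l.2.act X).comp (Pi.evalAddMonoidHom (fun l : Σ i : Q, Relation S i => X.vertex l.1) l)

theorem system_apply {S : QuiverRep Rᵐᵒᵖ Qᵒᵖ} (F : Finset (Σ i : Q, Relation S i))
    (X : QuiverRep R Q) (x) : system F X x = ∑ l ∈ F, l.2.act X (x l) := by
  simp [system, AddMonoidHom.finsetSum_apply]

theorem act_mem_range_system {S : QuiverRep Rᵐᵒᵖ Qᵒᵖ} {F : Finset (Σ i : Q, Relation S i)}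
    {X : QuiverRep R Q} {i : Q} {ρ : Relation S i} (h : ⟨i, ρ⟩ ∈ F) (x : X.vertex i) :
    ρ.act X x ∈ (system F X).range := by
  classical
  refine ⟨Pi.single ⟨i, ρ⟩ x, ?_⟩
  rw [system_apply, Finset.sum_eq_single_of_mem _ h]
  · simp
  · rintro l - hl
    rw [Pi.single_eq_of_ne hl, map_zero]

theorem range_system_mono {S : QuiverRep Rᵐᵒᵖ Qᵒᵖ} {F G : Finset (Σ i : Q, Relation S i)}
    (h : F ⊆ G) (X : QuiverRep R Q) : (system F X).range ≤ (system G X).range := by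
  rintro _ ⟨x, rfl⟩
  rw [system_apply]
  exact sum_mem fun l hl => act_mem_range_system (h hl) _

/-- This is the universal property of `preTo` as the joint cokernel of all relations: `q` descends
to the tensor product. Additivity in the second variable is built into `PreTensor`, so three kinds
of relation suffice. -/
theorem apply_eq_zero_of_preTo_eq_zero {S : QuiverRep Rᵐᵒᵖ Qᵒᵖ} {X : QuiverRep R Q} {A : Type*}
    [AddCommGroup A] (q : PreTensor S X →+ A)
    (hq : ∀ (i : Q) (ρ : Relation S i) (x : X.vertex i), q (ρ.act X x) = 0)
    (b : PreTensor S X) (hb : preTo S X b = 0) : q b = 0 := by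
  let ψ : Tensor S X →+ A :=
    tensorLift (fun i s x => q (preOf S X i s x))
      (fun i s s' x => by
        rw [← map_add, ← sub_eq_zero, ← map_sub]
        exact hq i (.add s s') x)
      (fun i s x x' => by rw [map_add, map_add])
      (fun i r s x => by
        rw [← sub_eq_zero, ← map_sub]
        exact hq i (.smul r s) x)
      (fun {i j} a s x => by
        rw [← sub_eq_zero, ← map_sub]
        exact hq i (.arrow a s) x)
  have hψ : ψ.comp (preTo S X) = q := pre_hom_ext fun i s x => by
    rw [AddMonoidHom.comp_apply, preTo, preLift_preOf, tmulHom_apply, tensorLift_tmul]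
  rw [← hψ, AddMonoidHom.comp_apply, hb, map_zero]

theorem exists_system_of_preTo_eq_zero {S : QuiverRep Rᵐᵒᵖ Qᵒᵖ} {X : QuiverRep R Q}
    (b : PreTensor S X) (hb : preTo S X b = 0) :
    ∃ F : Finset (Σ i : Q, Relation S i), b ∈ (system F X).range := by
  classical
  -- Directedness makes the supremum of these ranges a plain union, so one finite set accounts for
  -- `b`.
  have hdir : Directed (· ≤ ·) fun F : Finset (Σ i : Q, Relation S i) => (system F X).range :=
    fun F G => ⟨F ∪ G, range_system_mono Finset.subset_union_left X,
      range_system_mono Finset.subset_union_right X⟩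
  rw [← AddSubgroup.mem_iSup_of_directed hdir, ← QuotientAddGroup.eq_zero_iff]
  refine apply_eq_zero_of_preTo_eq_zero
    (QuotientAddGroup.mk' (⨆ F : Finset (Σ i : Q, Relation S i), (system F X).range))
    (fun i ρ x => ?_) b hb
  exact (QuotientAddGroup.eq_zero_iff _).2 (le_iSup (fun F => (system F X).range) {⟨i, ρ⟩}
    (act_mem_range_system (Finset.mem_singleton_self _) x))

/-! ### The representation `Hom_ℤ(X(-), A)` -/

/-- The group of additive maps from a left `R`-module to an abelian group, regarded as a right
`R`-module. -/
def AddDual (M A : Type*) [AddCommGroup M] [AddCommGroup A] := M →+ A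

namespace AddDual

variable {M N A : Type*} [AddCommGroup M] [AddCommGroup N] [AddCommGroup A]

instance : AddCommGroup (AddDual M A) := inferInstanceAs (AddCommGroup (M →+ A))

instance [Module R M] : Module Rᵐᵒᵖ (AddDual M A) where
  smul r φ := AddMonoidHom.comp φ (DistribSMul.toAddMonoidHom M r.unop)
  one_smul φ := AddMonoidHom.ext fun x => congrArg φ.toFun (one_smul R x)
  -- `unop` reverses products, which matches the reversal caused by precomposition.
  mul_smul r r' φ := AddMonoidHom.ext fun x => congrArg φ.toFun (mul_smul r'.unop r.unop x)
  smul_zero _ := rfl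
  smul_add _ _ _ := rfl
  add_smul r r' φ := AddMonoidHom.ext fun x =>
    (congrArg φ.toFun (add_smul r.unop r'.unop x)).trans (AddMonoidHom.map_add φ _ _)
  zero_smul φ := AddMonoidHom.ext fun x =>
    (congrArg φ.toFun (zero_smul R x)).trans (AddMonoidHom.map_zero φ)

/-- Precomposition with an `R`-linear map. -/
def precomp [Module R M] [Module R N] (f : M →ₗ[R] N) : AddDual N A →ₗ[Rᵐᵒᵖ] AddDual M A where
  toFun φ := AddMonoidHom.comp φ f.toAddMonoidHom
  map_add' _ _ := rfl
  map_smul' r φ := AddMonoidHom.ext fun x => congrArg φ.toFun (map_smul f r.unop x).symm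

end AddDual

/-- The representation `Hom_ℤ(X(-), A)` of `Qᵒᵖ` by right `R`-modules. -/
def dualRep (X : QuiverRep R Q) (A : Type u) [AddCommGroup A] : QuiverRep Rᵐᵒᵖ Qᵒᵖ :=
  Paths.lift
    { obj := fun i => ModuleCat.of Rᵐᵒᵖ (AddDual (X.vertex i.unop) A)
      map := fun a => ModuleCat.ofHom (AddDual.precomp (X.arrow a.unop).hom) }

section

variable {X : QuiverRep R Q} {A : Type u} [AddCommGroup A]

/-- An additive map on `X(i)` as an element of the dual representation. -/
def toDual {i : Q} (φ : X.vertex i →+ A) : (dualRep X A).vertex (Opposite.op i) := φ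

/-- The value of an element of the dual representation. -/
def ofDual {i : Q} (φ : (dualRep X A).vertex (Opposite.op i)) : X.vertex i →+ A := φ

theorem toDual_add {i : Q} (φ ψ : X.vertex i →+ A) : toDual (φ + ψ) = toDual φ + toDual ψ := rfl

theorem smul_toDual {i : Q} (r : R) (φ : X.vertex i →+ A) :
    MulOpposite.op r • toDual φ = toDual (φ.comp (DistribSMul.toAddMonoidHom _ r)) := rfl

theorem arrow_toDual {i j : Q} (a : i ⟶ j) (φ : X.vertex j →+ A) :
    ((dualRep X A).arrow a.op).hom (toDual φ) =
      toDual (φ.comp (X.arrow a).hom.toAddMonoidHom) := rfl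

variable (X A) in
/-- The evaluation `Hom_ℤ(X(-), A) ⊗_Q X → A`. -/
def evalDual : Tensor (dualRep X A) X →+ A :=
  tensorLift (fun _ φ x => ofDual φ x) (fun _ _ _ _ => rfl) (fun _ φ x x' => map_add (ofDual φ) x x')
    (fun _ _ _ _ => rfl) (fun _ _ _ => rfl)

theorem evalDual_tmul {i : Q} (φ : X.vertex i →+ A) (x : X.vertex i) :
    evalDual X A (tmul _ X i (toDual φ) x) = φ x :=
  tensorLift_tmul ..

end

/-! ### Finite systems of equations -/

/-- That `q` kills `ρ` over `X` says exactly that the functionals `q.comp (preOf S X i s)` satisfy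
`ρ` inside the dual representation; a relation among left factors persists after tensoring with any
`y`. Only the given `ρ` is used, so `s ↦ q.comp (preOf S X i s)` need not be a morphism of
representations. -/
theorem tmul_toDual_act_eq_zero {S : QuiverRep Rᵐᵒᵖ Qᵒᵖ} {X : QuiverRep R Q} {A : Type u}
    [AddCommGroup A] (q : PreTensor S X →+ A) (Y : QuiverRep R Q) {i : Q} (ρ : Relation S i)
    (hρ : ∀ x : X.vertex i, q (ρ.act X x) = 0) (y : Y.vertex i) :
    preLift (fun i s => tmulHom (dualRep X A) Y i (toDual (q.comp (preOf S X i s)))) (ρ.act Y y)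
      = 0 := by
  cases ρ with
  | add s s' =>
    have h : q.comp (preOf S X i (s + s')) = q.comp (preOf S X i s) + q.comp (preOf S X i s') :=
      AddMonoidHom.ext fun x => by
        simpa only [Relation.act, AddMonoidHom.sub_apply, AddMonoidHom.add_apply, map_sub, map_add,
          sub_eq_zero] using! hρ x
    simp only [Relation.act, AddMonoidHom.sub_apply, AddMonoidHom.add_apply, map_sub, map_add,
      preLift_preOf, h, toDual_add, tmulHom_apply, add_tmul, sub_self]
  | smul r s =>
    have h : q.comp (preOf S X i (MulOpposite.op r • s)) =
        (q.comp (preOf S X i s)).comp (DistribSMul.toAddMonoidHom _ r) :=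
      AddMonoidHom.ext fun x => by
        simpa only [Relation.act, AddMonoidHom.sub_apply, map_sub, sub_eq_zero] using! hρ x
    simp only [Relation.act, AddMonoidHom.sub_apply, map_sub, preLift_preOf, h, ← smul_toDual,
      tmulHom_apply, smul_tmul, AddMonoidHom.comp_apply, DistribSMul.toAddMonoidHom_apply, sub_self]
  | arrow a s =>
    have h : q.comp (preOf S X i ((S.arrow a.op).hom s)) =
        (q.comp (preOf S X _ s)).comp (X.arrow a).hom.toAddMonoidHom :=
      AddMonoidHom.ext fun x => by
        simpa only [Relation.act, AddMonoidHom.sub_apply, map_sub, sub_eq_zero] using! hρ x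
    simp only [Relation.act, AddMonoidHom.sub_apply, map_sub, preLift_preOf, h, ← arrow_toDual,
      tmulHom_apply, arrow_tmul, AddMonoidHom.comp_apply, LinearMap.toAddMonoidHom_coe, sub_self]

/-- A finite system of equations with constants in a pure subrepresentation that is solvable in the
ambient representation is solvable in the subrepresentation. -/
theorem IsPureMono.mem_range_system {X Y : QuiverRep R Q} {f : X ⟶ Y} (hf : IsPureMono f)
    {S : QuiverRep Rᵐᵒᵖ Qᵒᵖ} (F : Finset (Σ i : Q, Relation S i)) (b : PreTensor S X)
    (hb : preMap S f b ∈ (system F Y).range) : b ∈ (system F X).range := by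
  -- `A` is the cokernel of the system over `X`; only the kernel of `q` matters from here on.
  obtain ⟨A, _, q, hq⟩ : ∃ (A : Type u) (_ : AddCommGroup A) (q : PreTensor S X →+ A),
      ∀ b, q b = 0 ↔ b ∈ (system F X).range :=
    ⟨PreTensor S X ⧸ (system F X).range, inferInstance, QuotientAddGroup.mk' _,
      fun b => QuotientAddGroup.eq_zero_iff b⟩
  let τ (Z : QuiverRep R Q) : PreTensor S Z →+ Tensor (dualRep X A) Z :=
    preLift fun i s => tmulHom _ Z i (toDual (q.comp (preOf S X i s)))
  have hnat : (tensorMap _ f).comp (τ X) = (τ Y).comp (preMap S f) := pre_hom_ext fun i s x => by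
    simp only [τ, AddMonoidHom.comp_apply, preLift_preOf, preMap_preOf, tmulHom_apply,
      tensorMap_tmul]
  -- Evaluation recovers `q` from `τ X`, so it is enough to show `τ X b = 0`; purity reduces this to
  -- the vanishing of `τ Y` on the image of `b`.
  have heval : (evalDual X A).comp (τ X) = q := pre_hom_ext fun i s x => by
    simp only [τ, AddMonoidHom.comp_apply, preLift_preOf, tmulHom_apply, evalDual_tmul]
  have hY : τ Y (preMap S f b) = 0 := by
    obtain ⟨y, hy⟩ := hb
    rw [← hy, system_apply, map_sum]
    exact Finset.sum_eq_zero fun l hl => tmul_toDual_act_eq_zero q Y l.2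
      (fun x => (hq _).2 (act_mem_range_system hl x)) (y l)
  have hX : τ X b = 0 := hf _ (by
    rw [← AddMonoidHom.comp_apply, hnat, AddMonoidHom.comp_apply, hY, map_zero])
  rw [← hq, ← heval, AddMonoidHom.comp_apply, hX, map_zero]

/-! ### Products -/

section

variable {ι : Type u} (X : ι → QuiverRep R Q)

theorem vertex_pi_ext {i : Q} {x y : (∏ᶜ X).vertex i}
    (h : ∀ k, (homAt (Pi.π X k) i).hom x = (homAt (Pi.π X k) i).hom y) : x = y :=
  Concrete.Pi.map_ext X ((evaluation _ (ModuleCat.{u} R)).obj ((Paths.of Q).obj i)) x y h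

theorem exists_vertex_pi {i : Q} (x : ∀ k, (X k).vertex i) :
    ∃ z : (∏ᶜ X).vertex i, ∀ k, (homAt (Pi.π X k) i).hom z = x k := by
  let e := (evaluation _ (ModuleCat.{u} R)).obj ((Paths.of Q).obj i)
  let w := (Concrete.productEquiv fun k => e.obj (X k)).symm x
  refine ⟨(PreservesProduct.iso e X).inv w, fun k => ?_⟩
  have h : (PreservesProduct.iso e X).inv ≫ e.map (Pi.π X k) = Pi.π (fun k => e.obj (X k)) k := by
    rw [Iso.inv_comp_eq]
    exact (piComparison_comp_π e X k).symm
  exact (congrArg (fun g => g.hom w) h).trans (Concrete.productEquiv_symm_apply_π _ x k)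

/-- A direct sum of products embeds in the product of the direct sums. -/
theorem preTensor_pi_ext {S : QuiverRep Rᵐᵒᵖ Qᵒᵖ} {b b' : PreTensor S (∏ᶜ X)}
    (h : ∀ k, preMap S (Pi.π X k) b = preMap S (Pi.π X k) b') : b = b' := by
  refine DFinsupp.ext fun t => vertex_pi_ext X fun k => ?_
  have := DFunLike.congr_fun (h k) t
  simpa [preMap, DirectSum.map_apply] using! this

end

theorem preMap_comp (S : QuiverRep Rᵐᵒᵖ Qᵒᵖ) {X Y Z : QuiverRep R Q} (f : X ⟶ Y) (g : Y ⟶ Z)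
    (b : PreTensor S X) : preMap S (f ≫ g) b = preMap S g (preMap S f b) := by
  have : preMap S (f ≫ g) = (preMap S g).comp (preMap S f) := pre_hom_ext fun i s x => by
    simp only [AddMonoidHom.comp_apply, preMap_preOf]
    rfl
  exact DFunLike.congr_fun this b

theorem preMap_system {S : QuiverRep Rᵐᵒᵖ Qᵒᵖ} {X Y : QuiverRep R Q} (f : X ⟶ Y)
    (F : Finset (Σ i : Q, Relation S i)) (x : ∀ l : Σ i : Q, Relation S i, X.vertex l.1) :
    preMap S f (system F X x) = system F Y fun l => (homAt f l.1).hom (x l) := by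
  simp only [system_apply, map_sum, preMap_act]

theorem IsPureMono.piMap {ι : Type u} {X Y : ι → QuiverRep R Q} {f : ∀ k, X k ⟶ Y k}
    (hf : ∀ k, IsPureMono (f k)) : IsPureMono (Limits.Pi.map f) := fun S => by
  refine (injective_iff_map_eq_zero _).2 fun t ht => ?_
  obtain ⟨b, rfl⟩ := preTo_surjective S _ t
  rw [tensorMap_preTo] at ht
  -- `F` is chosen over `∏ᶜ Y`, hence independently of `k`; this uniformity lets the componentwise
  -- solutions be combined.
  obtain ⟨F, y, hy⟩ := exists_system_of_preTo_eq_zero _ ht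
  have hk (k : ι) : preMap S (Pi.π X k) b ∈ (system F (X k)).range := by
    refine (hf k).mem_range_system F _ ?_
    rw [← preMap_comp, ← Pi.map_π, preMap_comp, ← hy, preMap_system]
    exact ⟨_, rfl⟩
  choose x hx using hk
  choose z hz using fun l : Σ i : Q, Relation S i => exists_vertex_pi X fun k => x k l
  have hb : system F (∏ᶜ X) z = b := preTensor_pi_ext X fun k => by
    rw [preMap_system, ← hx k]
    exact congrArg _ (funext fun l => hz l k)
  rw [← hb, system_apply, map_sum]
  exact Finset.sum_eq_zero fun l _ => preTo_act l.2 (z l)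

theorem epi_piMap {ι : Type u} {X Y : ι → QuiverRep R Q} (f : ∀ k, X k ⟶ Y k) [∀ k, Epi (f k)] :
    Epi (Limits.Pi.map f) := by
  refine (NatTrans.epi_iff_epi_app _).2 fun (i : Q) => (ModuleCat.epi_iff_surjective _).2 fun y => ?_
  choose x hx using fun k => homAt_surjective (f k) i ((homAt (Pi.π Y k) i).hom y)
  obtain ⟨z, hz⟩ := exists_vertex_pi X x
  refine ⟨z, vertex_pi_ext Y fun k => ?_⟩
  rw [← hx k, ← hz k]
  exact congrArg (fun g : (∏ᶜ X) ⟶ Y k => (homAt g i).hom z) (Pi.map_π f k)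

/-! ### Kernels and exactness of products -/

section

variable {ι : Type u} {X Y Z : ι → QuiverRep R Q} (f : ∀ k, X k ⟶ Y k) (g : ∀ k, Y k ⟶ Z k)

/-- The kernel of a product of morphisms is the product of the kernels. -/
noncomputable def kernelPiMapIso : kernel (Limits.Pi.map f) ≅ ∏ᶜ fun k => kernel (f k) where
  hom := Pi.lift fun k => kernel.lift (f k) (kernel.ι (Limits.Pi.map f) ≫ Pi.π X k) (by
    rw [Category.assoc, ← Pi.map_π, kernel.condition_assoc, zero_comp])
  inv := kernel.lift _ (Limits.Pi.map fun k => kernel.ι (f k)) (Pi.hom_ext _ _ fun k => by simp)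
  hom_inv_id := by
    rw [← cancel_mono (kernel.ι _)]
    exact Pi.hom_ext _ _ fun k => by simp
  inv_hom_id := Pi.hom_ext _ _ fun k => by
    rw [← cancel_mono (kernel.ι _)]
    simp

theorem kernelPiMapIso_hom_comp :
    (kernelPiMapIso f).hom ≫ Limits.Pi.map (fun k => kernel.ι (f k)) = kernel.ι (Limits.Pi.map f) :=
  Pi.hom_ext _ _ fun k => by simp [kernelPiMapIso]

theorem isPureMono_kernel_ι_piMap (h : ∀ k, IsPureMono (kernel.ι (f k))) :
    IsPureMono (kernel.ι (Limits.Pi.map f)) := by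
  rw [← kernelPiMapIso_hom_comp]
  exact (IsPureMono.of_isIso _).comp (.piMap h)

theorem piMap_comp_piMap_eq_zero (w : ∀ k, f k ≫ g k = 0) : Limits.Pi.map f ≫ Limits.Pi.map g = 0 :=
  Pi.hom_ext _ _ fun k => by simp [w k]

/-- Up to the identification of the kernel of a product with the product of kernels, the comparison
map to the kernel is a product of epimorphisms. -/
theorem exact_piMap (w : ∀ k, f k ≫ g k = 0)
    (h : ∀ k, (ShortComplex.mk (f k) (g k) (w k)).Exact) :
    (ShortComplex.mk (Limits.Pi.map f) (Limits.Pi.map g) (piMap_comp_piMap_eq_zero f g w)).Exact := by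
  rw [ShortComplex.exact_iff_epi_kernel_lift]
  have (k : ι) : Epi (kernel.lift (g k) (f k) (w k)) := (h k).epi_kernelLift
  have hcomp : kernel.lift (Limits.Pi.map g) (Limits.Pi.map f) (piMap_comp_piMap_eq_zero f g w) =
      Limits.Pi.map (fun k => kernel.lift (g k) (f k) (w k)) ≫ (kernelPiMapIso g).inv := by
    rw [← cancel_mono (kernel.ι _)]
    exact Pi.hom_ext _ _ fun k => by simp [kernelPiMapIso]
  have := epi_piMap fun k => kernel.lift (g k) (f k) (w k)
  change Epi (kernel.lift (Limits.Pi.map g) (Limits.Pi.map f) _)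
  rw [hcomp]
  infer_instance

end

/-! ### Products of pure injective resolutions -/

section

variable {X Y Z W : QuiverRep R Q}

/-- Replacing `g` by its corestriction to the kernel of `h` keeps exactness at `Y`, as the kernel
inclusion is mono; exactness at `Z` makes the corestriction epi. -/
theorem isPureExact_of_isPureMono (f : X ⟶ Y) (g : Y ⟶ Z) (h : Z ⟶ W) (w : f ≫ g = 0)
    (w' : g ≫ h = 0) [Mono f] (hf : IsPureMono f) (hfg : (ShortComplex.mk f g w).Exact)
    (hgh : (ShortComplex.mk g h w').Exact) (w'') :
    IsPureExact (ShortComplex.mk f (kernel.lift h g w') w'') := by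
  refine isPureExact_iff.2 ⟨?_, hf⟩
  have hepi : Epi (kernel.lift h g w') := hgh.epi_kernelLift
  refine ShortComplex.ShortExact.mk' ?_ ‹_› hepi
  let φ : ShortComplex.mk f (kernel.lift h g w') w'' ⟶ ShortComplex.mk f g w :=
    { τ₁ := 𝟙 _, τ₂ := 𝟙 _, τ₃ := kernel.ι h }
  have : Epi φ.τ₁ := inferInstanceAs (Epi (𝟙 X))
  have : IsIso φ.τ₂ := inferInstanceAs (IsIso (𝟙 Y))
  have : Mono φ.τ₃ := inferInstanceAs (Mono (kernel.ι h))
  exact (ShortComplex.exact_iff_of_epi_of_isIso_of_mono φ).2 hfg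

theorem exact_kernel_ι (f : X ⟶ Y) : (ShortComplex.mk (kernel.ι f) f (kernel.condition f)).Exact :=
  ShortComplex.exact_of_f_is_kernel _ (kernelIsKernel f)

end

/-- The product of a family of pure injective resolutions. -/
noncomputable def PureInjectiveResolution.pi {ι : Type u} {X : ι → QuiverRep R Q}
    (P : ∀ k, PureInjectiveResolution (X k)) : PureInjectiveResolution (∏ᶜ X) :=
  have hmono : Mono (Limits.Pi.map fun k => (P k).ε) :=
    have (k : ι) : Mono (P k).ε := (P k).mono_ε
    inferInstance
  have hexact (n : ℕ) := exact_piMap _ _ (fun k => (P k).d_d n) fun k => (P k).exact_succ n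
  { E n := ∏ᶜ fun k => (P k).E n
    ε := Limits.Pi.map fun k => (P k).ε
    d n := Limits.Pi.map fun k => (P k).d n
    ε_d := piMap_comp_piMap_eq_zero _ _ fun k => (P k).ε_d
    d_d n := piMap_comp_piMap_eq_zero _ _ fun k => (P k).d_d n
    injective n :=
      have (k : ι) : Injective ((P k).E n) := (P k).injective n
      inferInstance
    mono_ε := hmono
    exact_zero := exact_piMap _ _ (fun k => (P k).ε_d) fun k => (P k).exact_zero
    exact_succ := hexact
    pure_zero := isPureExact_of_isPureMono _ _ _ _ _
      (IsPureMono.piMap fun k => (isPureExact_iff.1 (P k).pure_zero).2)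
      (exact_piMap _ _ (fun k => (P k).ε_d) fun k => (P k).exact_zero) (hexact 0) _
    pure_succ n := isPureExact_of_isPureMono _ _ _ _ _
      (isPureMono_kernel_ι_piMap _ fun k => (isPureExact_iff.1 ((P k).pure_succ n)).2)
      (exact_kernel_ι _) (hexact (n + 1)) _ }

end QuiverRep

theorem corollary3p11 (R : Type u) [Ring R] (Q : Type u) [Quiver.{u} Q]
    (hfin : IsLocallyTargetFinite Q) (hroot : IsRightRooted Q)
    (ι : Type u) (X : ι → QuiverRep R Q) (hX : ∀ i, (X i).IsStronglyFPInjective) :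
    (∏ᶜ X).IsStronglyFPInjective :=
  ⟨.pi fun i => (hX i).some⟩
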